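/- **Setting.** Let $N\ge 1$. A lower triangular matrix $H=(h_{k,j})\in\mathbb R^{(N-1)\times(N-1)}$ represents the fixed-point algorithm $$y_{k+1}=y_k-\sum_{j=0}^{k}h_{k+1,j+1}\,(y_j-\mathbb T y_j),\qquad k=0,\dots,N-2,$$ for nonexpansive $\mathbb T\colon\mathbb R^d\to\mathbb R^d$ and starting point $y_0\in\mathbb R^d$. A deterministic algorithm with $N-1$ operator evaluations computes $y_{k+1}$ from $y_0,\dots,y_k$ and $\mathbb T y_0,\dots,\mathbb T y_k$ by fixed maps; its worst case in $\mathbb R^d$ is the supremum of $\|y_{N-1}-\mathbb T y_{N-1}\|^2/\|y_0-y_\star\|^2$ over all nonexpansive $\mathbb T\colon\mathbb R^d\to\mathbb R^d$, all $y_0$, and all fixed points $y_\star\ne y_0$ of $\mathbb T$. An algorithm is *minimax optimal* in $\mathbb R^d$ if its worst case is the smallest among all deterministic algorithms with $N-1$ evaluations. The *H-dual* of $H$ is its anti-diagonal transpose, $(H^{\mathsf A})_{k,j}=h_{N-j,N-k}$. For $1\le m\le N-1$ put $$P(N-1,m;H)=\sum_{1\le j(1)\le i(1)<j(2)\le i(2)<\cdots<j(m)\le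 i(m)\le N-1}\ \prod_{r=1}^m h_{i(r),j(r)},$$ and let $Q(N-1,m,j;H)$ be the part of this sum with $j(1)=j$. $H$ satisfies *H-invariance* if $P(N-1,m;H)=\frac1N\binom N{m+1}$ for $m=1,\dots,N-1$. In that case its *H-certificates* are the unique reals $\lambda^\star_{k,j}(H)$, $1\le j<k\le N$, such that $$0=N\|g_N\|^2+\langle g_N,x_N-y_0\rangle+\sum_{1\le j<k\le N}\lambda^\star_{k,j}\,\langle x_k-x_j,\,g_k-g_j\rangle$$ holds identically in the vectors $y_0,g_1,\dots,g_N$, where $y_k=y_{k-1}-\sum_{j=1}^{k}2h_{k,j}g_j$ for $1\le k\le N-1$ and $x_k=y_{k-1}-g_k$ for $1\le k\le N$. **Result.** Let $N=4$ and $$H_{\rm strange}=\begin{bmatrix}\tfrac34&&\\-\tfrac14&\tfrac47&\\-\tfrac1{12}&-\tfrac1{14}&\tfrac7{12}\end{bmatrix}.$$ 1. $Q(3,1,1)=\frac5{12}$, $Q(3,1,2)=\frac12$, $Q(3,1,3)=\frac7{12}$, $Q(3,2,1)=\frac23$, $Q(3,2,2)=\frac13$, $Q(3,3,1)=\frac14$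 for $H_{\rm strange}$. It satisfies H-invariance, and its H-certificates exist and are $\lambda^\star_{4,3}=\frac73$, $\lambda^\star_{4,2}=\frac23$, $\lambda^\star_{3,1}=\frac7{18}$, $\lambda^\star_{2,1}=\lambda^\star_{3,2}=\lambda^\star_{4,1}=0$; all are nonnegative. 2. $H_{\rm strange}$ is optimal: for every $d$, every nonexpansive $\mathbb T$ on $\mathbb R^d$, every $y_0$ and every fixed point $y_\star$ of $\mathbb T$, it satisfies $\|y_3-\mathbb T y_3\|^2\le 4\|y_0-y_\star\|^2/4^2$; and for every $d\ge 6$ it is minimax optimal in $\mathbb R^d$, with worst case exactly $4/4^2$. 3. Its H-dual is $$H_{\rm strange}^{\mathsf A}=\begin{bmatrix}\tfrac7{12}&&\\-\tfrac1{14}&\tfrac47&\\-\tfrac1{12}&-\tfrac14&\tfrac34\end{bmatrix}.$$ It satisfies H-invariance, and has $Q(3,1,1)=\frac37$, $Q(3,1,2)=\frac9{28}$, $Q(3,1,3)=\frac34$, $Q(3,2,1)=\frac47$, $Q(3,2,2)=\frac37$, $Q(3,3,1)=\frac14$. Its H-certificates exist, and $\lambda^\star_{4,2}(H_{\rm strange}^{\mathsf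 A})=-\frac37<0$. 4. $H_{\rm strange}^{\mathsf A}$ is not optimal: for every $d\ge5$ it violates the rate $\|y_3-\mathbb T y_3\|^2\le 4\|y_0-y_\star\|^2/4^2$ for some nonexpansive $\mathbb T$ on $\mathbb R^d$, some $y_0$ and some fixed point $y_\star$ of $\mathbb T$, and it is not minimax optimal in $\mathbb R^d$. 5. Hence H-duality does not preserve optimality: for every $d\ge 6$ it is false that the H-dual of every minimax optimal lower triangular $H\in\mathbb R^{3\times3}$ is minimax optimal in $\mathbb R^d$. -/

import Mathlib

open scoped ENNReal

/-- A deterministic algorithm on `E` making `n = N - 1` operator evaluations before its last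
iterate: from the points `y₀, …, y_k` queried so far and the oracle's answers `T y₀, …, T y_k` it
computes `y_{k+1}`, for `k = 0, …, n - 1`. -/
def DetAlgorithm (n : ℕ) (E : Type*) : Type _ :=
  (k : Fin n) → (Fin ((k : ℕ) + 1) → E × E) → E

/-- The iterate `y_k`, `k ≤ n`, produced by a deterministic algorithm for the operator `T` from the
starting point `y₀`. -/
def DetAlgorithm.iterate {n : ℕ} {E : Type*} (A : DetAlgorithm n E) (T : E → E) (y₀ : E) :
    (k : ℕ) → k ≤ n → E
  | 0, _ => y₀
  | k + 1, h => A ⟨k, h⟩ fun j =>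
      (A.iterate T y₀ j.val (by omega), T (A.iterate T y₀ j.val (by omega)))
termination_by k => k
decreasing_by all_goals exact j.isLt

/-- The terminal iterate `y_{N-1}`. -/
def DetAlgorithm.output {n : ℕ} {E : Type*} (A : DetAlgorithm n E) (T : E → E) (y₀ : E) : E :=
  A.iterate T y₀ n le_rfl

/-- The algorithm represented by the H-matrix `H`,
`y_{k+1} = y_k - ∑_{j ≤ k} h_{k+1,j+1} (y_j - T y_j)`.  Matrix indices are zero-based: the entry
written `h_{k+1,j+1}` in one-based notation is `H k j`.  Only entries on and below the diagonal
are used. -/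
def hAlgorithm {n : ℕ} {E : Type*} [AddCommGroup E] [Module ℝ E]
    (H : Matrix (Fin n) (Fin n) ℝ) : DetAlgorithm n E := fun k hist =>
  (hist (Fin.last (k : ℕ))).1 -
    ∑ j : Fin ((k : ℕ) + 1), H k (Fin.castLE k.isLt j) • ((hist j).1 - (hist j).2)

/-- The worst-case value of `‖y_{N-1} - T y_{N-1}‖² / ‖y₀ - y⋆‖²` over all nonexpansive `T`, all
starting points `y₀` and all fixed points `y⋆ ≠ y₀` of `T`. -/
noncomputable def worstCase {n d : ℕ} (A : DetAlgorithm n (EuclideanSpace ℝ (Fin d))) : ℝ≥0∞ :=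
  ⨆ (T : EuclideanSpace ℝ (Fin d) → EuclideanSpace ℝ (Fin d))
    (y₀ : EuclideanSpace ℝ (Fin d)) (ystar : EuclideanSpace ℝ (Fin d))
    (_ : LipschitzWith 1 T) (_ : T ystar = ystar) (_ : y₀ ≠ ystar),
    ENNReal.ofReal (‖A.output T y₀ - T (A.output T y₀)‖ ^ 2 / ‖y₀ - ystar‖ ^ 2)

/-- `A` minimizes the worst case over all deterministic algorithms with the same number of operator
evaluations in the same space. -/
def IsMinimaxOptimal {n d : ℕ} (A : DetAlgorithm n (EuclideanSpace ℝ (Fin d))) : Prop :=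
  ∀ B : DetAlgorithm n (EuclideanSpace ℝ (Fin d)), worstCase A ≤ worstCase B

/-- The algorithm of `H` has the rate `‖y_{N-1} - T y_{N-1}‖² ≤ 4 ‖y₀ - y⋆‖² / N²`, `N = n + 1`,
over all nonexpansive operators on `ℝ^d` and all their fixed points `y⋆`. -/
def HasOptimalRate {n : ℕ} (d : ℕ) (H : Matrix (Fin n) (Fin n) ℝ) : Prop :=
  ∀ (T : EuclideanSpace ℝ (Fin d) → EuclideanSpace ℝ (Fin d))
    (y₀ ystar : EuclideanSpace ℝ (Fin d)), LipschitzWith 1 T → T ystar = ystar →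
    ‖(hAlgorithm H).output T y₀ - T ((hAlgorithm H).output T y₀)‖ ^ 2 ≤
      4 * ‖y₀ - ystar‖ ^ 2 / ((n : ℝ) + 1) ^ 2

/-- Lower triangular matrices. -/
def IsLowerTriangular {n : ℕ} (H : Matrix (Fin n) (Fin n) ℝ) : Prop :=
  ∀ k j : Fin n, k < j → H k j = 0

/-- The anti-diagonal transpose, in one-based notation `(H^A)_{k,j} = H_{N-j,N-k}`. -/
def antiTranspose {n : ℕ} (H : Matrix (Fin n) (Fin n) ℝ) : Matrix (Fin n) (Fin n) ℝ :=
  Matrix.of fun k j => H j.rev k.rev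

/-- `P(N-1, m; H)`, `n = N - 1`: the sum of `∏_r h_{i(r),j(r)}` over all index sequences with
`j(1) ≤ i(1) < j(2) ≤ i(2) < ⋯ < j(m) ≤ i(m)`.  Here `s r = (i(r), j(r))`. -/
def hP {n : ℕ} (H : Matrix (Fin n) (Fin n) ℝ) (m : ℕ) : ℝ :=
  ∑ s : Fin m → Fin n × Fin n with
      (∀ r, (s r).2 ≤ (s r).1) ∧ (∀ r t, r < t → (s r).1 < (s t).2),
    ∏ r, H (s r).1 (s r).2

/-- `Q(N-1, m, j; H)`, for `m ≥ 1`: the part of the sum `P(N-1, m; H)` with `j(1) = j`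
(the column `j` is zero-based). -/
def hQ {n : ℕ} (H : Matrix (Fin n) (Fin n) ℝ) (m : ℕ) (j : Fin n) : ℝ :=
  ∑ s : Fin m → Fin n × Fin n with
      (∀ r, (s r).2 ≤ (s r).1) ∧ (∀ r t, r < t → (s r).1 < (s t).2) ∧
      (∀ r : Fin m, (r : ℕ) = 0 → (s r).2 = j),
    ∏ r, H (s r).1 (s r).2

/-- The H-invariance conditions `P(N-1, m; H) = (1/N) (N choose m+1)`, `m = 1, …, N-1`. -/
def HInvariance {n : ℕ} (H : Matrix (Fin n) (Fin n) ℝ) : Prop :=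
  ∀ m : ℕ, 1 ≤ m → m ≤ n →
    hP H m = 1 / ((n : ℝ) + 1) * (Nat.choose (n + 1) (m + 1) : ℝ)

/-- The certificate identity
`0 = N ‖g_N‖² + ⟨g_N, x_N - y₀⟩ + ∑_{j < k} lam_{k,j} ⟨x_k - x_j, g_k - g_j⟩`
in the free vectors `y₀, g_1, …, g_N`, where `y_k = y_{k-1} - ∑_{j ≤ k} 2 h_{k,j} g_j` and
`x_k = y_{k-1} - g_k`.  Indices of `lam`, `g`, `x` run over `Fin N`, so that `lam k j` is
`lam_{k+1,j+1}` in one-based notation, and `g k`, `x k = y k - g k` are `g_{k+1}`, `x_{k+1}`. -/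
def CertificateIdentity {n : ℕ} (H : Matrix (Fin n) (Fin n) ℝ)
    (lam : Fin (n + 1) → Fin (n + 1) → ℝ) : Prop :=
  ∀ (d : ℕ) (y g x : Fin (n + 1) → EuclideanSpace ℝ (Fin d)),
    (∀ k : Fin n,
      y k.succ = y k.castSucc - ∑ j : Fin n with j ≤ k, (2 * H k j) • g j.castSucc) →
    (∀ k, x k = y k - g k) →
    0 = ((n : ℝ) + 1) * ‖g (Fin.last n)‖ ^ 2
      + inner ℝ (g (Fin.last n)) (x (Fin.last n) - y 0)
      + ∑ k : Fin (n + 1), ∑ j : Fin (n + 1) with j < k,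
          lam k j * inner ℝ (x k - x j) (g k - g j)

/-- `lam k j`, for `j < k`, are the H-certificates of `H`: `H` satisfies the H-invariance
conditions, and these are the unique values satisfying the certificate identity. -/
def IsHCertificate {n : ℕ} (H : Matrix (Fin n) (Fin n) ℝ)
    (lam : Fin (n + 1) → Fin (n + 1) → ℝ) : Prop :=
  HInvariance H ∧ CertificateIdentity H lam ∧
    ∀ mu : Fin (n + 1) → Fin (n + 1) → ℝ, CertificateIdentity H mu →
      ∀ k j, j < k → mu k j = lam k j

/-- The strange 3-iterate algorithm. -/
noncomputable def HStrange : Matrix (Fin 3) (Fin 3) ℝ :=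
  !![3 / 4, 0, 0;
     -1 / 4, 4 / 7, 0;
     -1 / 12, -1 / 14, 7 / 12]

/-!
The `Q`-functions satisfy a recursion in `m`, obtained by splitting off the first pair of the index
sequence (`hQ_succ_succ`), and `P` is the sum of the `Q`s over the first column (`hP_succ`). For
`3 × 3` matrices this gives polynomials in the entries, hence the numerical values and H-invariance.

The certificate identity is linear in inner products, so it holds in all Euclidean spaces if and
only if it holds for real numbers (`certificateIdentity_iff`). There it is an identity of quadratic
forms in four variables: the certificates are verified by expansion, and they are unique because
evaluation at suitable test vectors gives a nonsingular linear system.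

Nonnegative certificates imply the rate (`CertificateIdentity.hasOptimalRate`): putting
`g = (y - T y) / 2` and `x = y - g`, nonexpansiveness of `T` says `0 ≤ ⟪x_k - x_j, g_k - g_j⟫`, also
for the pair `(y⋆, 0)`. The identity leaves `N ‖g_N‖² ≤ ⟪g_N, y₀ - x_N⟫ ≤ ⟪g_N, y₀ - y⋆⟫`, and the
Cauchy-Schwarz inequality concludes.

No algorithm with three evaluations has a smaller worst case in dimension at least six
(`one_quarter_le_worstCase`). Let `T x = e₀ + S x`, where `S` is the shift `e₀ ↦ e₁ ↦ e₂ ↦ e₃ ↦ -e₀`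
of an orthonormal family, extended by zero, and start at `0`. The fixed point
`(e₀ + e₁ + e₂ + e₃) / 2` has norm one, and the coordinates of `x - T x` sum to `2 ⟪e₃, x⟫ - 1`,
so `‖x - T x‖ ≥ 1 / 2` whenever `⟪e₃, x⟫ ≤ 0`. The family is revealed only as the algorithm queries
the operator, so this inequality can be arranged for its output.

The dual algorithm already fails on the line (`exists_residual_antiTranspose_HStrange`): for
`T t = |t - 6/13| - 6/13`, with fixed point `0`, it produces `1, 6/13, 0, 4/13`, and the final
residual `8/13` exceeds `1/2`. Its worst case is therefore larger than that of the strange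
algorithm in every positive dimension.
-/

/-! ### The functions `P` and `Q` -/

theorem hQ_one {n : ℕ} (H : Matrix (Fin n) (Fin n) ℝ) (j : Fin n) :
    hQ H 1 j = ∑ i : Fin n with j ≤ i, H i j := by
  unfold hQ
  rw [Finset.sum_filter, Finset.sum_filter,
    ← (Equiv.funUnique (Fin 1) (Fin n × Fin n)).symm.sum_comp, Fintype.sum_prod_type]
  refine Finset.sum_congr rfl fun i _ => ?_
  rw [Finset.sum_eq_single j]
  · simp
  · intro b _ hb
    simp [hb]
  · simp

/-- Splitting off the first pair `(i(1), j(1)) = (i, j)` of an index sequence; `l` is `j(2)`. -/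
theorem hQ_succ_succ {n : ℕ} (H : Matrix (Fin n) (Fin n) ℝ) (m : ℕ) (j : Fin n) :
    hQ H (m + 2) j = ∑ i : Fin n with j ≤ i, H i j * ∑ l : Fin n with i < l, hQ H (m + 1) l := by
  unfold hQ
  rw [Finset.sum_filter, ← (Fin.consEquiv fun _ => Fin n × Fin n).sum_comp,
    Fintype.sum_prod_type, Fintype.sum_prod_type, Finset.sum_filter]
  refine Finset.sum_congr rfl fun i _ => ?_
  change ∑ b : Fin n, ∑ s : Fin (m + 1) → Fin n × Fin n,
    (if (∀ r, ((Fin.cons (i, b) s : Fin (m + 2) → Fin n × Fin n) r).2 ≤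
          ((Fin.cons (i, b) s : Fin (m + 2) → Fin n × Fin n) r).1) ∧
        (∀ r t, r < t → ((Fin.cons (i, b) s : Fin (m + 2) → Fin n × Fin n) r).1 <
          ((Fin.cons (i, b) s : Fin (m + 2) → Fin n × Fin n) t).2) ∧
        (∀ r : Fin (m + 2), (r : ℕ) = 0 →
          ((Fin.cons (i, b) s : Fin (m + 2) → Fin n × Fin n) r).2 = j)
      then ∏ r, H ((Fin.cons (i, b) s : Fin (m + 2) → Fin n × Fin n) r).1
          ((Fin.cons (i, b) s : Fin (m + 2) → Fin n × Fin n) r).2 else 0) = _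
  rw [Finset.sum_eq_single j]
  · by_cases hij : j ≤ i
    · rw [if_pos hij, Finset.mul_sum]
      simp only [Finset.sum_filter (s := (Finset.univ : Finset (Fin (m + 1) → Fin n × Fin n))),
        Finset.mul_sum]
      rw [Finset.sum_comm]
      refine Finset.sum_congr rfl fun s _ => ?_
      rw [Fin.prod_univ_succ]
      simp only [Fin.cons_zero, Fin.cons_succ]
      -- only the column `l = j(2)` contributes
      rw [Finset.sum_filter, Finset.sum_eq_single (s 0).2]
      · have key : ((∀ r, ((Fin.cons (i, j) s : Fin (m + 2) → Fin n × Fin n) r).2 ≤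
              ((Fin.cons (i, j) s : Fin (m + 2) → Fin n × Fin n) r).1) ∧
            (∀ r t, r < t → ((Fin.cons (i, j) s : Fin (m + 2) → Fin n × Fin n) r).1 <
              ((Fin.cons (i, j) s : Fin (m + 2) → Fin n × Fin n) t).2) ∧
            (∀ r : Fin (m + 2), (r : ℕ) = 0 →
              ((Fin.cons (i, j) s : Fin (m + 2) → Fin n × Fin n) r).2 = j)) ↔
            i < (s 0).2 ∧ (∀ r, (s r).2 ≤ (s r).1) ∧
              (∀ r t, r < t → (s r).1 < (s t).2) ∧
              ∀ r : Fin (m + 1), (r : ℕ) = 0 → (s r).2 = (s 0).2 := by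
          constructor
          · rintro ⟨h₁, h₂, -⟩
            refine ⟨by simpa using h₂ 0 1 Fin.zero_lt_one, fun r => by simpa using h₁ r.succ,
              fun r t hrt => by simpa using h₂ r.succ t.succ (Fin.succ_lt_succ_iff.2 hrt),
              fun r hr => ?_⟩
            rw [show r = 0 from Fin.ext hr]
          · rintro ⟨h₀, h₁, h₂, -⟩
            refine ⟨Fin.cases (by simpa using hij) fun r => by simpa using h₁ r,
              Fin.cases (Fin.cases (by simp) fun t _ => ?_)
                fun r => Fin.cases (by simp) fun t hrt => ?_,
              Fin.cases (by simp) (by simp)⟩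
            · simp only [Fin.cons_zero, Fin.cons_succ]
              rcases Fin.eq_zero_or_eq_succ t with rfl | ⟨t, rfl⟩
              · exact h₀
              · exact (h₀.trans_le (h₁ 0)).trans (h₂ 0 _ (Fin.succ_pos t))
            · simpa using h₂ r t (Fin.succ_lt_succ_iff.1 hrt)
        simp only [key, ite_and]
        split_ifs <;> simp_all
      · refine fun l _ hl => ite_eq_right_iff.2 fun _ => ?_
        rw [if_neg fun h => hl (h.2.2 0 rfl).symm, mul_zero]
      · simp
    · rw [if_neg hij]
      refine Finset.sum_eq_zero fun s _ => if_neg fun h => hij ?_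
      simpa using h.1 0
  · intro b _ hb
    refine Finset.sum_eq_zero fun s _ => if_neg fun h => hb ?_
    simpa using h.2.2 0
  · simp

theorem hP_succ {n : ℕ} (H : Matrix (Fin n) (Fin n) ℝ) (m : ℕ) :
    hP H (m + 1) = ∑ j : Fin n, hQ H (m + 1) j := by
  unfold hP hQ
  rw [← Finset.sum_fiberwise _ fun s => (s 0).2]
  refine Finset.sum_congr rfl fun j _ => ?_
  rw [Finset.filter_filter]
  refine Finset.sum_congr (Finset.filter_congr fun s _ => ?_) fun _ _ => rfl
  simp [Fin.forall_fin_succ, and_assoc]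

theorem antiTranspose_HStrange :
    antiTranspose HStrange =
      !![7 / 12, 0, 0;
         -1 / 14, 4 / 7, 0;
         -1 / 12, -1 / 4, 3 / 4] := by
  ext k j
  fin_cases k <;> fin_cases j <;> simp [antiTranspose, HStrange, Fin.rev]

theorem HStrange_entries :
    HStrange 0 0 = 3 / 4 ∧ HStrange 1 0 = -1 / 4 ∧ HStrange 1 1 = 4 / 7 ∧
      HStrange 2 0 = -1 / 12 ∧ HStrange 2 1 = -1 / 14 ∧ HStrange 2 2 = 7 / 12 :=
  ⟨rfl, rfl, rfl, rfl, rfl, rfl⟩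

theorem antiTranspose_HStrange_entries :
    antiTranspose HStrange 0 0 = 7 / 12 ∧ antiTranspose HStrange 1 0 = -1 / 14 ∧
      antiTranspose HStrange 1 1 = 4 / 7 ∧ antiTranspose HStrange 2 0 = -1 / 12 ∧
      antiTranspose HStrange 2 1 = -1 / 4 ∧ antiTranspose HStrange 2 2 = 3 / 4 :=
  ⟨rfl, rfl, rfl, rfl, rfl, rfl⟩

section ThreeByThree

variable (H : Matrix (Fin 3) (Fin 3) ℝ)

theorem hQ_one_fin_three :
    hQ H 1 0 = H 0 0 + H 1 0 + H 2 0 ∧ hQ H 1 1 = H 1 1 + H 2 1 ∧ hQ H 1 2 = H 2 2 := by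
  simp [hQ_one, Finset.sum_filter, Fin.sum_univ_three]

theorem hQ_two_fin_three :
    hQ H 2 0 = H 0 0 * (H 1 1 + H 2 1 + H 2 2) + H 1 0 * H 2 2 ∧
      hQ H 2 1 = H 1 1 * H 2 2 ∧ hQ H 2 2 = 0 := by
  simp [hQ_succ_succ H 0, hQ_one_fin_three H, Finset.sum_filter, Fin.sum_univ_three]

theorem hQ_three_fin_three :
    hQ H 3 0 = H 0 0 * H 1 1 * H 2 2 ∧ hQ H 3 1 = 0 ∧ hQ H 3 2 = 0 := by
  simp [hQ_succ_succ H 1, hQ_two_fin_three H, Finset.sum_filter, Fin.sum_univ_three, mul_assoc]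

end ThreeByThree

theorem hQ_HStrange :
    hQ HStrange 1 0 = 5 / 12 ∧ hQ HStrange 1 1 = 1 / 2 ∧ hQ HStrange 1 2 = 7 / 12 ∧
      hQ HStrange 2 0 = 2 / 3 ∧ hQ HStrange 2 1 = 1 / 3 ∧ hQ HStrange 3 0 = 1 / 4 := by
  simp only [hQ_one_fin_three, hQ_two_fin_three, hQ_three_fin_three]
  norm_num [HStrange_entries]

theorem hQ_antiTranspose_HStrange :
    hQ (antiTranspose HStrange) 1 0 = 3 / 7 ∧ hQ (antiTranspose HStrange) 1 1 = 9 / 28 ∧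
      hQ (antiTranspose HStrange) 1 2 = 3 / 4 ∧ hQ (antiTranspose HStrange) 2 0 = 4 / 7 ∧
      hQ (antiTranspose HStrange) 2 1 = 3 / 7 ∧ hQ (antiTranspose HStrange) 3 0 = 1 / 4 := by
  simp only [hQ_one_fin_three, hQ_two_fin_three, hQ_three_fin_three]
  norm_num [antiTranspose_HStrange_entries]

theorem hInvariance_fin_three {H : Matrix (Fin 3) (Fin 3) ℝ}
    (h₁ : hQ H 1 0 + hQ H 1 1 + hQ H 1 2 = 3 / 2) (h₂ : hQ H 2 0 + hQ H 2 1 = 1)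
    (h₃ : hQ H 3 0 = 1 / 4) : HInvariance H := by
  intro m hm hm'
  interval_cases m
  · rw [hP_succ H 0, Fin.sum_univ_three, h₁]
    norm_num [Nat.choose]
  · rw [hP_succ H 1, Fin.sum_univ_three, h₂, (hQ_two_fin_three H).2.2]
    norm_num [Nat.choose]
  · rw [hP_succ H 2, Fin.sum_univ_three, h₃, (hQ_three_fin_three H).2.1,
      (hQ_three_fin_three H).2.2]
    norm_num [Nat.choose]

theorem hInvariance_HStrange : HInvariance HStrange := by
  obtain ⟨h₁, h₂, h₃, h₄, h₅, h₆⟩ := hQ_HStrange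
  exact hInvariance_fin_three (by rw [h₁, h₂, h₃]; norm_num) (by rw [h₄, h₅]; norm_num) h₆

theorem hInvariance_antiTranspose_HStrange : HInvariance (antiTranspose HStrange) := by
  obtain ⟨h₁, h₂, h₃, h₄, h₅, h₆⟩ := hQ_antiTranspose_HStrange
  exact hInvariance_fin_three (by rw [h₁, h₂, h₃]; norm_num) (by rw [h₄, h₅]; norm_num) h₆

/-! ### H-certificates -/

/-- The certificate identity is linear in inner products, so it may be tested on real numbers: it
holds in every Euclidean space as soon as it holds on the line, by summing over coordinates. -/
theorem certificateIdentity_iff {n : ℕ} {H : Matrix (Fin n) (Fin n) ℝ}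
    {lam : Fin (n + 1) → Fin (n + 1) → ℝ} :
    CertificateIdentity H lam ↔ ∀ y g : Fin (n + 1) → ℝ,
      (∀ k : Fin n,
        y k.succ = y k.castSucc - ∑ j : Fin n with j ≤ k, 2 * H k j * g j.castSucc) →
      0 = ((n : ℝ) + 1) * g (Fin.last n) ^ 2
        + (y (Fin.last n) - g (Fin.last n) - y 0) * g (Fin.last n)
        + ∑ k : Fin (n + 1), ∑ j : Fin (n + 1) with j < k,
            lam k j * ((g k - g j) * (y k - g k - (y j - g j))) := by
  constructor
  · intro h y g hy
    have := h 1 (fun k => EuclideanSpace.single 0 (y k)) (fun k => EuclideanSpace.single 0 (g k))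
      (fun k => EuclideanSpace.single 0 (y k) - EuclideanSpace.single 0 (g k)) (fun k => by
        ext i
        simp [Subsingleton.elim i 0, hy k]) fun _ => rfl
    simpa [PiLp.inner_apply, EuclideanSpace.real_norm_sq_eq] using this
  · intro h d y g x hy hx
    have key := fun i : Fin d => h (fun k => y k i) (fun k => g k i) fun k => by
      simp [hy k]
    have hsum := Finset.sum_congr rfl fun (i : Fin d) (_ : i ∈ Finset.univ) => key i
    rw [Finset.sum_const_zero, Finset.sum_add_distrib, Finset.sum_add_distrib,
      ← Finset.mul_sum, Finset.sum_comm] at hsum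
    rw [EuclideanSpace.real_norm_sq_eq, hsum, PiLp.inner_apply]
    congr 1
    · congr 1
      simp [hx]
    · refine Finset.sum_congr rfl fun k _ => ?_
      rw [Finset.sum_comm]
      refine Finset.sum_congr rfl fun j _ => ?_
      simp [PiLp.inner_apply, Finset.mul_sum, hx]

/-- For `N = 4` the iterates can be eliminated from the scalar identity, because only the
differences `y k - y 0` occur in it. -/
theorem certificateIdentity_fin_three {H : Matrix (Fin 3) (Fin 3) ℝ}
    {lam : Fin 4 → Fin 4 → ℝ} :
    CertificateIdentity H lam ↔ ∀ g₀ g₁ g₂ g₃ a b c : ℝ, a = -(2 * H 0 0 * g₀) →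
      b = a - (2 * H 1 0 * g₀ + 2 * H 1 1 * g₁) →
      c = b - (2 * H 2 0 * g₀ + 2 * H 2 1 * g₁ + 2 * H 2 2 * g₂) →
      0 = 4 * g₃ ^ 2 + (c - g₃) * g₃ + lam 1 0 * ((g₁ - g₀) * (a - g₁ + g₀))
        + lam 2 0 * ((g₂ - g₀) * (b - g₂ + g₀)) + lam 2 1 * ((g₂ - g₁) * (b - g₂ - (a - g₁)))
        + lam 3 0 * ((g₃ - g₀) * (c - g₃ + g₀)) + lam 3 1 * ((g₃ - g₁) * (c - g₃ - (a - g₁)))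
        + lam 3 2 * ((g₃ - g₂) * (c - g₃ - (b - g₂))) := by
  rw [certificateIdentity_iff]
  constructor
  · intro h g₀ g₁ g₂ g₃ a b c ha hb hc
    have := h ![0, a, b, c] ![g₀, g₁, g₂, g₃] (by
      intro k
      fin_cases k <;> simp [Finset.sum_filter, Fin.sum_univ_three, ha, hb, hc])
    simp [Finset.sum_filter, Fin.sum_univ_four, Fin.last] at this
    linear_combination this
  · intro h y g hy
    have h₀ := hy 0
    have h₁ := hy 1
    have h₂ := hy 2
    simp [Finset.sum_filter, Fin.sum_univ_three] at h₀ h₁ h₂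
    have := h (g 0) (g 1) (g 2) (g 3) (y 1 - y 0) (y 2 - y 0) (y 3 - y 0)
      (by linear_combination h₀) (by linear_combination h₁) (by linear_combination h₂)
    simp [Finset.sum_filter, Fin.sum_univ_four, Fin.last]
    linear_combination this

/-- The identity evaluated at the unit vectors of the four variables `g₀, g₁, g₂, g₃` and at the
sums of the second and third and of the third and fourth of them.  For the two matrices considered
below, these six linear equations determine the six certificates. -/
theorem CertificateIdentity.equations {H : Matrix (Fin 3) (Fin 3) ℝ} {lam : Fin 4 → Fin 4 → ℝ}
    (h : CertificateIdentity H lam) :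
    (2 * H 0 0 - 1) * lam 1 0 + (2 * H 0 0 + 2 * H 1 0 - 1) * lam 2 0
        + (2 * H 0 0 + 2 * H 1 0 + 2 * H 2 0 - 1) * lam 3 0 = 0 ∧
      (2 * H 1 1 - 1) * lam 2 1 + (2 * H 1 1 + 2 * H 2 1 - 1) * lam 3 1 - lam 1 0 = 0 ∧
      (2 * H 2 2 - 1) * lam 3 2 - lam 2 0 - lam 2 1 = 0 ∧
      lam 3 0 + lam 3 1 + lam 3 2 = 3 ∧
      (2 * H 1 1 + 2 * H 2 1 + 2 * H 2 2 - 1) * lam 3 1 + (2 * H 2 1 + 2 * H 2 2 - 1) * lam 3 2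
        - lam 1 0 - (2 * H 1 1 + 1) * lam 2 0 = 0 ∧
      lam 2 0 + lam 2 1 + (2 * H 2 2 + 1) * (lam 3 0 + lam 3 1) = 3 - 2 * H 2 2 := by
  rw [certificateIdentity_fin_three] at h
  have t₀ := h 1 0 0 0 _ _ _ rfl rfl rfl
  have t₁ := h 0 1 0 0 _ _ _ rfl rfl rfl
  have t₂ := h 0 0 1 0 _ _ _ rfl rfl rfl
  have t₃ := h 0 0 0 1 _ _ _ rfl rfl rfl
  have t₁₂ := h 0 1 1 0 _ _ _ rfl rfl rfl
  have t₂₃ := h 0 0 1 1 _ _ _ rfl rfl rfl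
  refine ⟨?_, ?_, ?_, ?_, ?_, ?_⟩
  · linear_combination -t₀
  · linear_combination -t₁
  · linear_combination -t₂
  · linear_combination t₃
  · linear_combination -t₁₂
  · linear_combination t₂₃

theorem isHCertificate_HStrange :
    IsHCertificate HStrange !![0, 0, 0, 0; 0, 0, 0, 0; 7 / 18, 0, 0, 0; 0, 2 / 3, 7 / 3, 0] := by
  obtain ⟨e₁, e₂, e₃, e₄, e₅, e₆⟩ := HStrange_entries
  refine ⟨hInvariance_HStrange, certificateIdentity_fin_three.2 ?_, fun mu hmu => ?_⟩
  · intro g₀ g₁ g₂ g₃ a b c ha hb hc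
    simp only [e₁, e₂, e₃, e₄, e₅, e₆] at ha hb hc
    subst ha hb hc
    simp
    ring
  · obtain ⟨t₀, t₁, t₂, t₃, t₁₂, t₂₃⟩ := hmu.equations
    simp only [e₁, e₂, e₃, e₄, e₅, e₆] at t₀ t₁ t₂ t₃ t₁₂ t₂₃
    intro k j hjk
    fin_cases k <;> fin_cases j <;> first | exact absurd hjk (by decide) | (simp; linarith)

theorem isHCertificate_antiTranspose_HStrange :
    IsHCertificate (antiTranspose HStrange)
      !![0, 0, 0, 0; 3 / 7, 0, 0, 0; -3 / 7, 27 / 14, 0, 0; 3 / 7, -3 / 7, 3, 0] := by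
  obtain ⟨e₁, e₂, e₃, e₄, e₅, e₆⟩ := antiTranspose_HStrange_entries
  refine ⟨hInvariance_antiTranspose_HStrange, certificateIdentity_fin_three.2 ?_,
    fun mu hmu => ?_⟩
  · intro g₀ g₁ g₂ g₃ a b c ha hb hc
    simp only [e₁, e₂, e₃, e₄, e₅, e₆] at ha hb hc
    subst ha hb hc
    simp
    ring
  · obtain ⟨t₀, t₁, t₂, t₃, t₁₂, t₂₃⟩ := hmu.equations
    simp only [e₁, e₂, e₃, e₄, e₅, e₆] at t₀ t₁ t₂ t₃ t₁₂ t₂₃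
    intro k j hjk
    fin_cases k <;> fin_cases j <;> first | exact absurd hjk (by decide) | (simp; linarith)

theorem HStrange_certificates_nonneg : ∀ k j : Fin 4, j < k →
    0 ≤ (!![0, 0, 0, 0; 0, 0, 0, 0; 7 / 18, 0, 0, 0; 0, 2 / 3, 7 / 3, 0] :
      Matrix (Fin 4) (Fin 4) ℝ) k j := by
  intro k j hjk
  fin_cases k <;> fin_cases j <;> simp <;> norm_num

/-! ### Iterates -/

theorem DetAlgorithm.iterate_zero {n : ℕ} {E : Type*} (A : DetAlgorithm n E) (T : E → E)
    (y₀ : E) (h : 0 ≤ n) : A.iterate T y₀ 0 h = y₀ := by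
  rw [DetAlgorithm.iterate]

theorem DetAlgorithm.iterate_succ {n : ℕ} {E : Type*} (A : DetAlgorithm n E) (T : E → E)
    (y₀ : E) (k : ℕ) (h : k + 1 ≤ n) :
    A.iterate T y₀ (k + 1) h = A ⟨k, h⟩ fun j =>
      (A.iterate T y₀ j.val (by omega), T (A.iterate T y₀ j.val (by omega))) := by
  rw [DetAlgorithm.iterate]

/-- For `hAlgorithm H` the sum over the history is a sum over the indices `j ≤ k`. -/
theorem hAlgorithm_iterate_succ {n : ℕ} {E : Type*} [AddCommGroup E] [Module ℝ E]
    (H : Matrix (Fin n) (Fin n) ℝ) (T : E → E) (y₀ : E) (k : Fin n) :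
    (hAlgorithm H).iterate T y₀ (k + 1) k.isLt =
      (hAlgorithm H).iterate T y₀ k k.isLt.le - ∑ j : Fin n with j ≤ k,
        H k j • ((hAlgorithm H).iterate T y₀ j j.isLt.le -
          T ((hAlgorithm H).iterate T y₀ j j.isLt.le)) := by
  rw [DetAlgorithm.iterate_succ]
  simp only [hAlgorithm, Fin.val_last]
  refine congrArg _ ?_
  refine Finset.sum_bij (fun (j : Fin ((k : ℕ) + 1)) _ => Fin.castLE k.isLt j) (fun j _ => ?_)
    (fun i _ j _ h => ?_) (fun j hj => ?_) fun j _ => rfl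
  · exact Finset.mem_filter.2 ⟨Finset.mem_univ _, Fin.le_def.2 (Nat.lt_succ_iff.1 j.isLt)⟩
  · exact Fin.castLE_injective _ h
  · exact ⟨⟨j, Nat.lt_succ_iff.2 (Finset.mem_filter.1 hj).2⟩, Finset.mem_univ _, rfl⟩

/-! ### The rate from nonnegative certificates -/

/-- Firm nonexpansiveness: if `T` is nonexpansive, then `(1 + T) / 2` and `(1 - T) / 2` have
nonnegative correlation. -/
theorem LipschitzWith.inner_half_nonneg {E : Type*} [NormedAddCommGroup E]
    [InnerProductSpace ℝ E] {T : E → E} (hT : LipschitzWith 1 T) (u v : E) :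
    0 ≤ inner ℝ ((u - (1 / 2 : ℝ) • (u - T u)) - (v - (1 / 2 : ℝ) • (v - T v)))
      ((1 / 2 : ℝ) • (u - T u) - (1 / 2 : ℝ) • (v - T v)) := by
  have h : ‖T u - T v‖ ≤ ‖u - v‖ := by simpa [dist_eq_norm] using hT.dist_le_mul u v
  have e₁ : (u - (1 / 2 : ℝ) • (u - T u)) - (v - (1 / 2 : ℝ) • (v - T v)) =
      (1 / 2 : ℝ) • ((u - v) + (T u - T v)) := by module
  have e₂ : (1 / 2 : ℝ) • (u - T u) - (1 / 2 : ℝ) • (v - T v) =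
      (1 / 2 : ℝ) • ((u - v) - (T u - T v)) := by module
  rw [e₁, e₂]
  generalize u - v = p at h
  generalize T u - T v = q at h
  rw [real_inner_smul_left, real_inner_smul_right, inner_add_left, inner_sub_right,
    inner_sub_right, real_inner_self_eq_norm_sq, real_inner_self_eq_norm_sq, real_inner_comm p q]
  nlinarith [norm_nonneg q]

/-- Nonnegative certificates prove the optimal rate: with `g = (y - T y) / 2` all inner products
in the certificate identity are nonnegative, which leaves
`N ‖g_N‖² ≤ ⟪g_N, y₀ - x_N⟫ ≤ ⟪g_N, y₀ - y⋆⟫`. -/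
theorem CertificateIdentity.hasOptimalRate {n : ℕ} {H : Matrix (Fin n) (Fin n) ℝ}
    {lam : Fin (n + 1) → Fin (n + 1) → ℝ} (h : CertificateIdentity H lam)
    (hlam : ∀ k j, j < k → 0 ≤ lam k j) (d : ℕ) : HasOptimalRate d H := by
  intro T y₀ ystar hT hfix
  set y : Fin (n + 1) → EuclideanSpace ℝ (Fin d) := fun k =>
    (hAlgorithm H).iterate T y₀ k (Nat.lt_succ_iff.1 k.isLt) with hy
  set g : Fin (n + 1) → EuclideanSpace ℝ (Fin d) := fun k => (1 / 2 : ℝ) • (y k - T (y k)) with hg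
  have hid := h d y g (fun k => y k - g k) (fun k => by
    have := hAlgorithm_iterate_succ H T y₀ k
    simp only [hy, hg, Fin.val_succ, Fin.val_castSucc, smul_smul, this]
    congr 1
    refine Finset.sum_congr rfl fun j _ => ?_
    congr 1
    ring) fun _ => rfl
  have hsum : 0 ≤ ∑ k : Fin (n + 1), ∑ j : Fin (n + 1) with j < k,
      lam k j * inner ℝ (y k - g k - (y j - g j)) (g k - g j) :=
    Finset.sum_nonneg fun k _ => Finset.sum_nonneg fun j hj =>
      mul_nonneg (hlam k j (Finset.mem_filter.1 hj).2) (hT.inner_half_nonneg (y k) (y j))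
  have hy0 : y 0 = y₀ := DetAlgorithm.iterate_zero _ _ _ _
  have hout : (hAlgorithm H).output T y₀ = y (Fin.last n) := rfl
  have hstar := hT.inner_half_nonneg (y (Fin.last n)) ystar
  rw [hfix, sub_self, smul_zero, sub_zero, sub_zero] at hstar
  change 0 ≤ inner ℝ (y (Fin.last n) - g (Fin.last n) - ystar) (g (Fin.last n)) at hstar
  rw [hy0] at hid
  rw [hout, show y (Fin.last n) - T (y (Fin.last n)) = (2 : ℝ) • g (Fin.last n) by
    rw [hg, smul_smul]; norm_num, norm_smul]
  generalize g (Fin.last n) = G at *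
  generalize y (Fin.last n) = Y at *
  have hcs := real_inner_le_norm G (y₀ - ystar)
  have e : inner ℝ G (y₀ - ystar) =
      inner ℝ (Y - G - ystar) G - inner ℝ G (Y - G - y₀) := by
    rw [real_inner_comm G, ← inner_sub_right]
    congr 1
    abel
  have hn : (0 : ℝ) < (n : ℝ) + 1 := by positivity
  have hle : ((n : ℝ) + 1) * ‖G‖ ≤ ‖y₀ - ystar‖ := by
    rcases (norm_nonneg G).eq_or_lt with h0 | h0
    · rw [← h0, mul_zero]
      exact norm_nonneg _
    · refine le_of_mul_le_mul_left ?_ h0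
      nlinarith
  rw [le_div_iff₀ (by positivity)]
  have := pow_le_pow_left₀ (by positivity) hle 2
  norm_num
  nlinarith

/-! ### Worst cases -/

theorem HasOptimalRate.worstCase_le {n d : ℕ} {H : Matrix (Fin n) (Fin n) ℝ}
    (h : HasOptimalRate d H) :
    worstCase (hAlgorithm H : DetAlgorithm n (EuclideanSpace ℝ (Fin d))) ≤
      ENNReal.ofReal (4 / ((n : ℝ) + 1) ^ 2) := by
  refine iSup_le fun T => iSup_le fun y₀ => iSup_le fun ystar => iSup_le fun hT =>
    iSup_le fun hfix => iSup_le fun hne => ENNReal.ofReal_le_ofReal ?_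
  have : 0 < ‖y₀ - ystar‖ := norm_pos_iff.2 (sub_ne_zero.2 hne)
  rw [div_le_iff₀ (by positivity)]
  exact (h T y₀ ystar hT hfix).trans_eq (by ring)

theorem le_worstCase {n d : ℕ} (A : DetAlgorithm n (EuclideanSpace ℝ (Fin d)))
    {T : EuclideanSpace ℝ (Fin d) → EuclideanSpace ℝ (Fin d)} {y₀ ystar : EuclideanSpace ℝ (Fin d)}
    (hT : LipschitzWith 1 T) (hfix : T ystar = ystar) (hne : y₀ ≠ ystar) :
    ENNReal.ofReal (‖A.output T y₀ - T (A.output T y₀)‖ ^ 2 / ‖y₀ - ystar‖ ^ 2) ≤ worstCase A :=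
  le_iSup_of_le T <| le_iSup_of_le y₀ <| le_iSup_of_le ystar <| le_iSup_of_le hT <|
    le_iSup_of_le hfix <| le_iSup_of_le hne le_rfl

/-! ### The resisting oracle -/

theorem exists_unit_orthogonal {E : Type*} [NormedAddCommGroup E] [InnerProductSpace ℝ E]
    [FiniteDimensional ℝ E] {m : ℕ} (v : Fin m → E) (hm : m < Module.finrank ℝ E) :
    ∃ u : E, ‖u‖ = 1 ∧ ∀ i, inner ℝ u (v i) = 0 := by
  have hne : (Submodule.span ℝ (Set.range v))ᗮ ≠ ⊥ := by
    rw [Ne, Submodule.orthogonal_eq_bot_iff]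
    intro h
    have := finrank_range_le_card (R := ℝ) v
    rw [Set.finrank, h, finrank_top, Fintype.card_fin] at this
    omega
  obtain ⟨w, hw, hw0⟩ := Submodule.exists_mem_ne_zero_of_ne_bot hne
  refine ⟨(‖w‖⁻¹ : ℝ) • w, by
    rw [norm_smul, norm_inv, norm_norm, inv_mul_cancel₀ (norm_ne_zero_iff.2 hw0)], fun i => ?_⟩
  rw [real_inner_smul_left, real_inner_comm, Submodule.inner_right_of_mem_orthogonal
    (Submodule.subset_span (Set.mem_range_self i)) hw, mul_zero]

section CyclicShift

variable {E : Type*} [NormedAddCommGroup E] [InnerProductSpace ℝ E]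

/-- The operator `x ↦ e₀ + S x`, where `S` is zero on the orthogonal complement of
`e₀, e₁, e₂, e₃` and shifts `e₀ ↦ e₁ ↦ e₂ ↦ e₃ ↦ -e₀`. -/
noncomputable def shiftOperator (e : Fin 4 → E) (x : E) : E :=
  e 0 + (inner ℝ (e 0) x • e 1 + inner ℝ (e 1) x • e 2 + inner ℝ (e 2) x • e 3
    - inner ℝ (e 3) x • e 0)

variable {e : Fin 4 → E}

theorem Orthonormal.lipschitzWith_shiftOperator (he : Orthonormal ℝ e) :
    LipschitzWith 1 (shiftOperator e) := by
  refine LipschitzWith.of_dist_le_mul fun x z => ?_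
  rw [NNReal.coe_one, one_mul, dist_eq_norm, dist_eq_norm]
  have hS : shiftOperator e x - shiftOperator e z =
      ∑ i, (![-inner ℝ (e 3) (x - z), inner ℝ (e 0) (x - z), inner ℝ (e 1) (x - z),
        inner ℝ (e 2) (x - z)] : Fin 4 → ℝ) i • e i := by
    simp only [shiftOperator, Fin.sum_univ_four, inner_sub_right, Matrix.cons_val]
    module
  have hB := he.sum_inner_products_le (s := Finset.univ) (x - z)
  refine (sq_le_sq₀ (norm_nonneg _) (norm_nonneg _)).1 ?_
  rw [hS, ← real_inner_self_eq_norm_sq, he.inner_sum]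
  simp only [Fin.sum_univ_four, Real.norm_eq_abs, sq_abs] at hB ⊢
  simp
  nlinarith

theorem Orthonormal.inner_sum_four (he : Orthonormal ℝ e) (i : Fin 4) :
    inner ℝ (e i) (e 0 + e 1 + e 2 + e 3) = (1 : ℝ) := by
  simp only [inner_add_right, orthonormal_iff_ite.1 he]
  fin_cases i <;> simp

theorem Orthonormal.norm_sum_four_sq (he : Orthonormal ℝ e) :
    ‖e 0 + e 1 + e 2 + e 3‖ ^ 2 = 4 := by
  rw [← real_inner_self_eq_norm_sq]
  nth_rw 1 [inner_add_left, inner_add_left, inner_add_left]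
  simp only [he.inner_sum_four]
  norm_num

theorem Orthonormal.shiftOperator_half_sum (he : Orthonormal ℝ e) :
    shiftOperator e ((1 / 2 : ℝ) • (e 0 + e 1 + e 2 + e 3)) =
      (1 / 2 : ℝ) • (e 0 + e 1 + e 2 + e 3) := by
  simp only [shiftOperator, real_inner_smul_right, he.inner_sum_four]
  module

/-- The sum of the coordinates of the residual is `2 ⟪e₃, x⟫ - 1`, so that the residual has norm
at least `1 / 2` at every point with a nonpositive last coordinate. -/
theorem Orthonormal.one_quarter_le_residual (he : Orthonormal ℝ e) {x : E}
    (hx : inner ℝ (e 3) x ≤ (0 : ℝ)) : 1 / 4 ≤ ‖x - shiftOperator e x‖ ^ 2 := by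
  have h : inner ℝ (e 0 + e 1 + e 2 + e 3) (x - shiftOperator e x) = 2 * inner ℝ (e 3) x - 1 := by
    have hu : ∀ i, inner ℝ (e 0 + e 1 + e 2 + e 3) (e i) = (1 : ℝ) := fun i => by
      rw [real_inner_comm, he.inner_sum_four]
    simp only [shiftOperator, inner_sub_right, inner_add_right, real_inner_smul_right, hu]
    simp only [inner_add_left]
    ring
  have hcs := abs_real_inner_le_norm (e 0 + e 1 + e 2 + e 3) (x - shiftOperator e x)
  have hcs' := pow_le_pow_left₀ (abs_nonneg _) hcs 2
  rw [sq_abs, mul_pow, he.norm_sum_four_sq, h] at hcs'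
  nlinarith

end CyclicShift

/-- Against any algorithm with three evaluations the orthonormal vectors can be chosen during the
run.  Each new vector is orthogonal to the earlier ones and to the points queried so far, and `e₃`
is only asked to have a nonpositive inner product with the output, which a choice of sign achieves.
Thus `e₃` has to avoid the span of the five vectors `e₀, e₁, e₂, y₁, y₂`: this is where dimension
six is needed. -/
theorem one_quarter_le_worstCase {d : ℕ} (hd : 6 ≤ d)
    (A : DetAlgorithm 3 (EuclideanSpace ℝ (Fin d))) :
    ENNReal.ofReal (1 / 4) ≤ worstCase A := by
  have hfr : Module.finrank ℝ (EuclideanSpace ℝ (Fin d)) = d := by simp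
  obtain ⟨e₀, n₀, -⟩ := exists_unit_orthogonal (E := EuclideanSpace ℝ (Fin d)) ![] (by omega)
  set y₁ := A 0 fun _ => (0, e₀) with hy₁
  obtain ⟨e₁, n₁, o₁⟩ := exists_unit_orthogonal ![e₀, y₁] (by omega)
  set y₂ := A 1 ![(0, e₀), (y₁, e₀ + inner ℝ e₀ y₁ • e₁)] with hy₂
  obtain ⟨e₂, n₂, o₂⟩ := exists_unit_orthogonal ![e₀, e₁, y₁, y₂] (by omega)
  set y₃ := A 2 ![(0, e₀), (y₁, e₀ + inner ℝ e₀ y₁ • e₁),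
    (y₂, e₀ + (inner ℝ e₀ y₂ • e₁ + inner ℝ e₁ y₂ • e₂))] with hy₃
  obtain ⟨e₃, n₃, o₃, hs⟩ : ∃ u, ‖u‖ = 1 ∧ (∀ i, inner ℝ u (![e₀, e₁, e₂, y₁, y₂] i) = 0) ∧
      inner ℝ u y₃ ≤ 0 := by
    -- no answer before the output involves `e₃`, hence its sign is still free
    obtain ⟨u, hu, ou⟩ := exists_unit_orthogonal ![e₀, e₁, e₂, y₁, y₂] (by omega)
    rcases le_total (inner ℝ u y₃) 0 with h | h
    · exact ⟨u, hu, ou, h⟩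
    · exact ⟨-u, by rwa [norm_neg], fun i => by rw [inner_neg_left, ou i, neg_zero],
        by rw [inner_neg_left]; linarith⟩
  simp only [Fin.forall_fin_succ, Matrix.cons_val_zero, Matrix.cons_val_succ,
    IsEmpty.forall_iff, and_true] at o₁ o₂ o₃
  obtain ⟨o₁₀, p₁₁⟩ := o₁
  obtain ⟨o₂₀, o₂₁, p₂₁, p₂₂⟩ := o₂
  obtain ⟨o₃₀, o₃₁, o₃₂, p₃₁, p₃₂⟩ := o₃
  set e := ![e₀, e₁, e₂, e₃] with hedef
  have he : Orthonormal ℝ e := by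
    rw [orthonormal_iff_ite]
    have o₀₁ := (real_inner_comm e₁ e₀).trans o₁₀
    have o₀₂ := (real_inner_comm e₂ e₀).trans o₂₀
    have o₀₃ := (real_inner_comm e₃ e₀).trans o₃₀
    have o₁₂ := (real_inner_comm e₂ e₁).trans o₂₁
    have o₁₃ := (real_inner_comm e₃ e₁).trans o₃₁
    have o₂₃ := (real_inner_comm e₃ e₂).trans o₃₂
    intro i j
    fin_cases i <;> fin_cases j <;> simp [*]
  have hT : ∀ x, shiftOperator e x = e₀ + (inner ℝ e₀ x • e₁ + inner ℝ e₁ x • e₂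
    + inner ℝ e₂ x • e₃ - inner ℝ e₃ x • e₀) := fun x => rfl
  have i₀ : A.iterate (shiftOperator e) 0 0 (by omega) = 0 := A.iterate_zero _ _ _
  have t₀ : shiftOperator e 0 = e₀ := by simp [hT]
  have i₁ : A.iterate (shiftOperator e) 0 1 (by omega) = y₁ := by
    rw [A.iterate_succ _ _ 0 (by omega), hy₁]
    refine congrArg (A 0) (funext fun j => ?_)
    fin_cases j
    simp [i₀, t₀]
  have t₁ : shiftOperator e y₁ = e₀ + inner ℝ e₀ y₁ • e₁ := by simp [hT, p₁₁, p₂₁, p₃₁]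
  have i₂ : A.iterate (shiftOperator e) 0 2 (by omega) = y₂ := by
    rw [A.iterate_succ _ _ 1 (by omega), hy₂]
    refine congrArg (A 1) (funext fun j => ?_)
    fin_cases j <;> simp [i₀, t₀, i₁, t₁]
  have t₂ : shiftOperator e y₂ = e₀ + (inner ℝ e₀ y₂ • e₁ + inner ℝ e₁ y₂ • e₂) := by
    simp [hT, p₂₂, p₃₂]
  have i₃ : A.output (shiftOperator e) 0 = y₃ := by
    rw [DetAlgorithm.output, A.iterate_succ _ _ 2 (by omega), hy₃]
    refine congrArg (A 2) (funext fun j => ?_)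
    fin_cases j <;> simp [i₀, t₀, i₁, t₁, i₂, t₂]
  -- the fixed point `(e₀ + e₁ + e₂ + e₃) / 2` is at unit distance from `y₀ = 0`
  have hnorm : ‖0 - (1 / 2 : ℝ) • (e 0 + e 1 + e 2 + e 3)‖ ^ 2 = 1 := by
    rw [zero_sub, norm_neg, norm_smul, mul_pow, he.norm_sum_four_sq]
    norm_num
  refine le_trans (ENNReal.ofReal_le_ofReal ?_) (le_worstCase A he.lipschitzWith_shiftOperator
    he.shiftOperator_half_sum (y₀ := 0) fun h => ?_)
  · rw [i₃, hnorm, div_one]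
    exact he.one_quarter_le_residual hs
  · rw [← h] at hnorm
    simp at hnorm

/-! ### The dual of the strange algorithm on the line -/

/-- A linear map that intertwines two operators maps the iterates to each other. -/
theorem hAlgorithm_iterate_map {n : ℕ} {E F : Type*} [AddCommGroup E] [Module ℝ E]
    [AddCommGroup F] [Module ℝ F] (H : Matrix (Fin n) (Fin n) ℝ) (φ : E →ₗ[ℝ] F) {S : E → E}
    {T : F → F} (h : ∀ x, T (φ x) = φ (S x)) (y₀ : E) (k : ℕ) (hk : k ≤ n) :
    (hAlgorithm H).iterate T (φ y₀) k hk = φ ((hAlgorithm H).iterate S y₀ k hk) := by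
  induction k using Nat.strong_induction_on with
  | _ k ih =>
    rcases k with - | k
    · rw [DetAlgorithm.iterate_zero, DetAlgorithm.iterate_zero]
    · rw [hAlgorithm_iterate_succ H T _ ⟨k, hk⟩, hAlgorithm_iterate_succ H S _ ⟨k, hk⟩, map_sub,
        map_sum, ih k k.lt_succ_self]
      refine congrArg _ (Finset.sum_congr rfl fun j hj => ?_)
      rw [ih j (Nat.lt_succ_of_le (Finset.mem_filter.1 hj).2), h, map_smul, map_sub]

/-- Starting from `1`, the dual algorithm produces `6/13`, `0` and `4/13` for the operator
`t ↦ |t - 6/13| - 6/13` on the line. -/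
theorem output_abs_sub :
    (hAlgorithm (antiTranspose HStrange)).output (fun t : ℝ => |t - 6 / 13| - 6 / 13) 1 =
      4 / 13 := by
  obtain ⟨a₁, a₂, a₃, a₄, a₅, a₆⟩ := antiTranspose_HStrange_entries
  set f : ℝ → ℝ := fun t => |t - 6 / 13| - 6 / 13 with hf
  have f₀ : f 1 = 1 / 13 := by rw [hf]; dsimp only; rw [abs_of_pos] <;> norm_num
  have f₁ : f (6 / 13) = -6 / 13 := by norm_num [hf]
  have f₂ : f 0 = 0 := by rw [hf]; dsimp only; rw [abs_of_neg] <;> norm_num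
  have step := hAlgorithm_iterate_succ (antiTranspose HStrange) f 1
  have i₀ : (hAlgorithm (antiTranspose HStrange)).iterate f 1 0 (by omega) = 1 :=
    DetAlgorithm.iterate_zero _ _ _ _
  have i₁ : (hAlgorithm (antiTranspose HStrange)).iterate f 1 1 (by omega) = 6 / 13 := by
    refine (step 0).trans ?_
    simp [Finset.sum_filter, i₀, f₀, a₁]
    norm_num
  have i₂ : (hAlgorithm (antiTranspose HStrange)).iterate f 1 2 (by omega) = 0 := by
    refine (step 1).trans ?_
    simp [Finset.sum_filter, Fin.sum_univ_three, i₀, f₀, i₁, f₁, a₂, a₃]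
    norm_num
  refine (step 2).trans ?_
  simp [Finset.sum_filter, Fin.sum_univ_three, i₀, f₀, i₁, f₁, i₂, f₂, a₄, a₅, a₆]
  norm_num

/-- The operator `t ↦ |t - 6/13| - 6/13` acting on the first coordinate has the fixed point `0`
and is nonexpansive; the dual algorithm started at unit distance from `0` ends with a residual of
norm `8/13 > 1/2`. -/
theorem exists_residual_antiTranspose_HStrange {d : ℕ} (hd : 0 < d) :
    ∃ (T : EuclideanSpace ℝ (Fin d) → EuclideanSpace ℝ (Fin d)) (y₀ : EuclideanSpace ℝ (Fin d)),
      LipschitzWith 1 T ∧ T 0 = 0 ∧ ‖y₀‖ = 1 ∧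
      ‖(hAlgorithm (antiTranspose HStrange)).output T y₀ -
        T ((hAlgorithm (antiTranspose HStrange)).output T y₀)‖ = 8 / 13 := by
  set u : EuclideanSpace ℝ (Fin d) := EuclideanSpace.single ⟨0, hd⟩ 1 with hu
  have hnorm : ‖u‖ = 1 := by simp [hu]
  set f : ℝ → ℝ := fun t => |t - 6 / 13| - 6 / 13 with hf
  have f₂ : f 0 = 0 := by rw [hf]; dsimp only; rw [abs_of_neg] <;> norm_num
  have f₃ : f (4 / 13) = -4 / 13 := by rw [hf]; dsimp only; rw [abs_of_neg] <;> norm_num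
  -- project to the line through `u` and apply `f` there
  set T : EuclideanSpace ℝ (Fin d) → EuclideanSpace ℝ (Fin d) := fun x => f (inner ℝ u x) • u
    with hT
  have hTu : ∀ t : ℝ, T (LinearMap.toSpanSingleton ℝ _ u t) =
      LinearMap.toSpanSingleton ℝ _ u (f t) := fun t => by
    simp [hT, real_inner_smul_right, hnorm]
  have hout : (hAlgorithm (antiTranspose HStrange)).output T u = (4 / 13 : ℝ) • u := by
    have := hAlgorithm_iterate_map (antiTranspose HStrange) _ hTu 1 3 le_rfl
    rw [LinearMap.toSpanSingleton_apply, one_smul] at this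
    refine this.trans ?_
    rw [LinearMap.toSpanSingleton_apply]
    exact congrArg (· • u) output_abs_sub
  refine ⟨T, u, LipschitzWith.of_dist_le_mul fun x z => ?_, ?_, hnorm, ?_⟩
  · rw [NNReal.coe_one, one_mul, dist_eq_norm, dist_eq_norm, hT, ← sub_smul, norm_smul, hnorm,
      mul_one, hf, sub_sub_sub_cancel_right, Real.norm_eq_abs]
    refine (abs_abs_sub_abs_le_abs_sub _ _).trans ?_
    rw [sub_sub_sub_cancel_right, ← inner_sub_right]
    exact (abs_real_inner_le_norm _ _).trans_eq (by rw [hnorm, one_mul])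
  · simp [hT, f₂]
  · have := hTu (4 / 13)
    rw [LinearMap.toSpanSingleton_apply, LinearMap.toSpanSingleton_apply, f₃] at this
    rw [hout, this, ← sub_smul, norm_smul, hnorm]
    norm_num

theorem not_hasOptimalRate_antiTranspose_HStrange {d : ℕ} (hd : 0 < d) :
    ¬ HasOptimalRate d (antiTranspose HStrange) := by
  obtain ⟨T, y₀, hT, hfix, hnorm, hres⟩ := exists_residual_antiTranspose_HStrange hd
  intro h
  have := h T y₀ 0 hT hfix
  rw [hres, sub_zero, hnorm] at this
  norm_num at this

theorem one_quarter_lt_worstCase_antiTranspose_HStrange {d : ℕ} (hd : 0 < d) :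
    ENNReal.ofReal (1 / 4) < worstCase
      (hAlgorithm (antiTranspose HStrange) : DetAlgorithm 3 (EuclideanSpace ℝ (Fin d))) := by
  obtain ⟨T, y₀, hT, hfix, hnorm, hres⟩ := exists_residual_antiTranspose_HStrange hd
  refine lt_of_lt_of_le ?_ (le_worstCase _ hT hfix (y₀ := y₀) fun h => ?_)
  · rw [hres, sub_zero, hnorm]
    exact (ENNReal.ofReal_lt_ofReal_iff (by norm_num)).2 (by norm_num)
  · rw [h, norm_zero] at hnorm
    norm_num at hnorm

/-! ### Optimality -/

theorem hasOptimalRate_HStrange (d : ℕ) : HasOptimalRate d HStrange :=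
  isHCertificate_HStrange.2.1.hasOptimalRate HStrange_certificates_nonneg d

theorem worstCase_HStrange_le (d : ℕ) :
    worstCase (hAlgorithm HStrange : DetAlgorithm 3 (EuclideanSpace ℝ (Fin d))) ≤
      ENNReal.ofReal (1 / 4) := by
  refine (hasOptimalRate_HStrange d).worstCase_le.trans_eq ?_
  norm_num

theorem isMinimaxOptimal_HStrange {d : ℕ} (hd : 6 ≤ d) :
    IsMinimaxOptimal (hAlgorithm HStrange : DetAlgorithm 3 (EuclideanSpace ℝ (Fin d))) :=
  fun B => (worstCase_HStrange_le d).trans (one_quarter_le_worstCase hd B)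

theorem not_isMinimaxOptimal_antiTranspose_HStrange {d : ℕ} (hd : 0 < d) :
    ¬ IsMinimaxOptimal
      (hAlgorithm (antiTranspose HStrange) : DetAlgorithm 3 (EuclideanSpace ℝ (Fin d))) :=
  fun h => ((one_quarter_lt_worstCase_antiTranspose_HStrange hd).trans_le
    (h (hAlgorithm HStrange))).not_ge (worstCase_HStrange_le d)

theorem mainTheorem10 :
    -- the Q-functions of the strange matrix
    (hQ HStrange 1 0 = 5 / 12 ∧ hQ HStrange 1 1 = 1 / 2 ∧ hQ HStrange 1 2 = 7 / 12 ∧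
      hQ HStrange 2 0 = 2 / 3 ∧ hQ HStrange 2 1 = 1 / 3 ∧ hQ HStrange 3 0 = 1 / 4) ∧
    -- its H-certificates (and H-invariance)
    (∃ lam : Fin 4 → Fin 4 → ℝ, IsHCertificate HStrange lam ∧
      lam 3 2 = 7 / 3 ∧ lam 3 1 = 2 / 3 ∧ lam 3 0 = 0 ∧
      lam 2 1 = 0 ∧ lam 2 0 = 7 / 18 ∧ lam 1 0 = 0 ∧
      ∀ k j, j < k → 0 ≤ lam k j) ∧
    -- its optimality
    (∀ d : ℕ, HasOptimalRate d HStrange) ∧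
    (∀ d : ℕ, 6 ≤ d →
      IsMinimaxOptimal (hAlgorithm HStrange : DetAlgorithm 3 (EuclideanSpace ℝ (Fin d))) ∧
      worstCase (hAlgorithm HStrange : DetAlgorithm 3 (EuclideanSpace ℝ (Fin d))) =
        ENNReal.ofReal (4 / 4 ^ 2)) ∧
    -- its H-dual
    antiTranspose HStrange =
      !![7 / 12, 0, 0;
         -1 / 14, 4 / 7, 0;
         -1 / 12, -1 / 4, 3 / 4] ∧
    HInvariance (antiTranspose HStrange) ∧
    (hQ (antiTranspose HStrange) 1 0 = 3 / 7 ∧ hQ (antiTranspose HStrange) 1 1 = 9 / 28 ∧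
      hQ (antiTranspose HStrange) 1 2 = 3 / 4 ∧ hQ (antiTranspose HStrange) 2 0 = 4 / 7 ∧
      hQ (antiTranspose HStrange) 2 1 = 3 / 7 ∧ hQ (antiTranspose HStrange) 3 0 = 1 / 4) ∧
    (∃ lam : Fin 4 → Fin 4 → ℝ, IsHCertificate (antiTranspose HStrange) lam ∧
      lam 3 1 = -3 / 7 ∧ lam 3 1 < 0) ∧
    -- the H-dual is not optimal
    (∀ d : ℕ, 5 ≤ d →
      ¬ HasOptimalRate d (antiTranspose HStrange) ∧
      ¬ IsMinimaxOptimal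
        (hAlgorithm (antiTranspose HStrange) : DetAlgorithm 3 (EuclideanSpace ℝ (Fin d)))) ∧
    -- optimality is not preserved by H-duality
    (∀ d : ℕ, 6 ≤ d →
      ¬ ∀ H : Matrix (Fin 3) (Fin 3) ℝ, IsLowerTriangular H →
        IsMinimaxOptimal (hAlgorithm H : DetAlgorithm 3 (EuclideanSpace ℝ (Fin d))) →
        IsMinimaxOptimal
          (hAlgorithm (antiTranspose H) : DetAlgorithm 3 (EuclideanSpace ℝ (Fin d)))) := by
  refine ⟨hQ_HStrange, ⟨_, isHCertificate_HStrange, rfl, rfl, rfl, rfl, rfl, rfl,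
      HStrange_certificates_nonneg⟩, hasOptimalRate_HStrange,
    fun d hd => ⟨isMinimaxOptimal_HStrange hd, ?_⟩,
    antiTranspose_HStrange, hInvariance_antiTranspose_HStrange, hQ_antiTranspose_HStrange,
    ⟨_, isHCertificate_antiTranspose_HStrange, rfl, by simp; norm_num⟩,
    fun d hd => ⟨not_hasOptimalRate_antiTranspose_HStrange (by omega),
      not_isMinimaxOptimal_antiTranspose_HStrange (by omega)⟩,
    fun d hd h => not_isMinimaxOptimal_antiTranspose_HStrange (by omega)
      (h HStrange ?_ (isMinimaxOptimal_HStrange hd))⟩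
  · rw [show (4 : ℝ) / 4 ^ 2 = 1 / 4 by norm_num]
    exact (worstCase_HStrange_le d).antisymm (one_quarter_le_worstCase hd _)
  · intro k j hkj
    fin_cases k <;> fin_cases j <;> first | exact absurd hkj (by decide) | rfl
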